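/- **Theorem.** Consider positive integer parts $k_p$ colored by one of the four primary colors $a,b,c,d$ or one of the six secondary colors $ab,ac,ad,bc,bd,cd$, ordered by $$1_{ab}<1_{ac}<1_{ad}<1_a<1_{bc}<1_{bd}<1_b<1_{cd}<1_c<1_d<2_{ab}<2_{ac}<\cdots .$$ A colored partition of $n$ is a finite (possibly empty) non-increasing sequence $(\lambda_1,\lambda_2,\dots)$ of such parts whose sizes add up to $n$. For non-negative integers $u,v,w,t,n$, let $A(u,v,w,t,n)$ be the number of partitions of $n$ into $u$ distinct parts with color $a$, $v$ distinct parts with color $b$, $w$ distinct parts with color $c$ and $t$ distinct parts with color $d$ (equal sizes being allowed for different colors). Let $B(u,v,w,t,n)$ be the number of colored partitions of $n$ such that 1. every part with a secondary color has size greater than $1$; 2. the sizes of any two consecutive parts $\lambda_i,\lambda_{i+1}$ differ by at least the entry, in the row of the color of $\lambda_i$ and the column of the color of $\lambda_{i+1}$, of the table $$ \begin{array}{|c|cccccccccc|} \hline \lambda_i\setminus\lambda_{i+1}&ab&ac&ad&a&bc&bd&b&cd&c&d\\ \hline ab&2&2&2&2&2&2&2&2&2&2\\ ac&1&2&2&2&2&2&2&2&2&2\\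 ad&1&1&2&2&1&2&2&2&2&2\\ a&1&1&1&1&2&2&2&2&2&2\\ bc&1&1&1&1&2&2&2&2&2&2\\ bd&1&1&1&1&1&2&2&2&2&2\\ b&1&1&1&1&1&1&1&2&2&2\\ cd&0&1&1&1&1&1&1&2&2&2\\ c&1&1&1&1&1&1&1&1&1&2\\ d&1&1&1&1&1&1&1&1&1&1\\ \hline \end{array} $$ 3. for no integer $k\ge 1$ do three consecutive parts form one of the patterns $((k+2)_{cd},(k+2)_{ab},k_c)$, $((k+2)_{cd},(k+2)_{ab},k_d)$, $((k+2)_{ad},(k+1)_{bc},k_a)$, except that the pattern $(3_{ad},2_{bc},1_a)$ is allowed; 4. there are $u$ parts with color $a,ab,ac$ or $ad$, $v$ parts with color $b,ab,bc$ or $bd$, $w$ parts with color $c,ac,bc$ or $cd$, and $t$ parts with color $d,ad,bd$ or $cd$. Then, for all non-negative integers $u,v,w,t,n$, both numbers are finite and $A(u,v,w,t,n)=B(u,v,w,t,n)$. Moreover, with $(x;q)_\infty=\prod_{k\ge 0}(1-xq^k)$, $$\sum_{u,v,w,t,n\ge 0} B(u,v,w,t,n)\,a^u b^v c^w d^t q^n=(-aq;q)_\infty(-bq;q)_\infty(-cq;q)_\infty(-dq;q)_\infty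 ,$$ both as formal power series over $\mathbb{Z}$ in the variables $a,b,c,d,q$ and, with both sides convergent, for all complex numbers $a,b,c,d,q$ with $|q|<1$. -/

import Mathlib

namespace TenColors

/-- The four primary colors. -/
inductive Primary
  | a | b | c | d
  deriving DecidableEq

/-- The ten colors: four primary and six secondary ones, listed in increasing order
`ab < ac < ad < a < bc < bd < b < cd < c < d`. -/
inductive Color
  | ab | ac | ad | a | bc | bd | b | cd | c | d
  deriving DecidableEq

/-- The position of a color in the order `ab < ac < ad < a < bc < bd < b < cd < c < d`. -/
def Color.rank : Color → Fin 10
  | .ab => 0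
  | .ac => 1
  | .ad => 2
  | .a => 3
  | .bc => 4
  | .bd => 5
  | .b => 6
  | .cd => 7
  | .c => 8
  | .d => 9

/-- The primary colors of which a color is made. -/
def Color.factors : Color → List Primary
  | .a => [.a]
  | .b => [.b]
  | .c => [.c]
  | .d => [.d]
  | .ab => [.a, .b]
  | .ac => [.a, .c]
  | .ad => [.a, .d]
  | .bc => [.b, .c]
  | .bd => [.b, .d]
  | .cd => [.c, .d]

def Color.IsPrimary (p : Color) : Prop := p.factors.length = 1

def Color.IsSecondary (p : Color) : Prop := p.factors.length = 2

/-- A colored part `k_p`, of size `k` and color `p`. -/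
@[ext]
structure Part where
  size : ℕ
  color : Color
  deriving DecidableEq

/-- The order `1_ab < 1_ac < 1_ad < 1_a < ⋯ < 1_d < 2_ab < ⋯` on colored parts (as `≤`). -/
def Part.Le (x y : Part) : Prop :=
  x.size < y.size ∨ (x.size = y.size ∧ x.color.rank ≤ y.color.rank)

/-- A partition into colored parts: a non-increasing finite sequence of colored parts of
positive size. -/
def IsColoredPartition (l : List Part) : Prop :=
  (∀ x ∈ l, 0 < x.size) ∧ l.Pairwise (fun x y => y.Le x)

/-- The integer that is partitioned. -/
def weight (l : List Part) : ℕ := (l.map Part.size).sum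

/-- The number of parts of `l` whose color is `p` or a secondary color involving `p`. -/
def colorCount (p : Primary) (l : List Part) : ℕ :=
  l.countP (fun x => decide (p ∈ x.color.factors))

/-- Partition of `n` in which the colors `a, b, c, d` are involved in `u, v, w, t` parts. -/
def HasStatistics (u v w t n : ℕ) (l : List Part) : Prop :=
  colorCount .a l = u ∧ colorCount .b l = v ∧ colorCount .c l = w ∧ colorCount .d l = t ∧
    weight l = n

/-- The table of minimal differences; rows and columns are ordered
`ab, ac, ad, a, bc, bd, b, cd, c, d`. -/
def minDiffTable : Matrix (Fin 10) (Fin 10) ℕ :=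
  !![2, 2, 2, 2, 2, 2, 2, 2, 2, 2;
     1, 2, 2, 2, 2, 2, 2, 2, 2, 2;
     1, 1, 2, 2, 1, 2, 2, 2, 2, 2;
     1, 1, 1, 1, 2, 2, 2, 2, 2, 2;
     1, 1, 1, 1, 2, 2, 2, 2, 2, 2;
     1, 1, 1, 1, 1, 2, 2, 2, 2, 2;
     1, 1, 1, 1, 1, 1, 1, 2, 2, 2;
     0, 1, 1, 1, 1, 1, 1, 2, 2, 2;
     1, 1, 1, 1, 1, 1, 1, 1, 1, 2;
     1, 1, 1, 1, 1, 1, 1, 1, 1, 1]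

/-- The minimal difference between a part of color `p` and the next part, of color `q`. -/
def minDiff (p q : Color) : ℕ := minDiffTable p.rank q.rank

/-- The sequence contains none of the patterns `((k+2)_cd, (k+2)_ab, k_c)`,
`((k+2)_cd, (k+2)_ab, k_d)`, `((k+2)_ad, (k+1)_bc, k_a)` (as consecutive parts), where the
pattern `(3_ad, 2_bc, 1_a)` is allowed nevertheless. -/
def AvoidsForbidden (l : List Part) : Prop :=
  ∀ k : ℕ,
    ¬ [⟨k + 2, .cd⟩, ⟨k + 2, .ab⟩, ⟨k, .c⟩] <:+: l ∧
    ¬ [⟨k + 2, .cd⟩, ⟨k + 2, .ab⟩, ⟨k, .d⟩] <:+: l ∧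
    (k ≠ 1 → ¬ [⟨k + 2, .ad⟩, ⟨k + 1, .bc⟩, ⟨k, .a⟩] <:+: l)

/-- Partitions into parts of primary colors, where the parts of each color are distinct. -/
def IsDistinctPrimary (l : List Part) : Prop :=
  IsColoredPartition l ∧ (∀ x ∈ l, x.color.IsPrimary) ∧ l.Nodup

/-- Partitions into parts of the ten colors with secondary parts larger than one, the minimal
differences of the table and no forbidden pattern. -/
def IsDifferencePartition (l : List Part) : Prop :=
  IsColoredPartition l ∧
    (∀ x ∈ l, x.color.IsSecondary → 1 < x.size) ∧
    l.IsChain (fun x y => y.size + minDiff x.color y.color ≤ x.size) ∧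
    AvoidsForbidden l

/-- The partitions counted by `A(u, v, w, t, n)`. -/
def setA (u v w t n : ℕ) : Set (List Part) :=
  {l | IsDistinctPrimary l ∧ HasStatistics u v w t n l}

/-- The partitions counted by `B(u, v, w, t, n)`. -/
def setB (u v w t n : ℕ) : Set (List Part) :=
  {l | IsDifferencePartition l ∧ HasStatistics u v w t n l}

noncomputable def numA (u v w t n : ℕ) : ℕ := (setA u v w t n).ncard

noncomputable def numB (u v w t n : ℕ) : ℕ := (setB u v w t n).ncard

/-- The infinite `q`-Pochhammer symbol `(x; q)_∞ = ∏_{k ≥ 0} (1 - x q ^ k)`. -/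
noncomputable def qPochInf {R : Type*} [CommRing R] [TopologicalSpace R] (x q : R) : R :=
  ∏' k : ℕ, (1 - x * q ^ k)

/-- The product `(x; q)_∞` converges. -/
def QPochConverges {R : Type*} [CommRing R] [TopologicalSpace R] (x q : R) : Prop :=
  Multipliable (fun k : ℕ => 1 - x * q ^ k)

/-- The `q`-series identity
`∑ B(u,v,w,t,n) a^u b^v c^w d^t q^n = (-aq;q)_∞ (-bq;q)_∞ (-cq;q)_∞ (-dq;q)_∞`
at elements `a, b, c, d, q` of a topological ring, including the convergence of both sides. -/
def SeriesIdentity {R : Type*} [CommRing R] [TopologicalSpace R] (a b c d q : R) : Prop :=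
  (QPochConverges (-a * q) q ∧ QPochConverges (-b * q) q ∧
    QPochConverges (-c * q) q ∧ QPochConverges (-d * q) q) ∧
  HasSum
    (fun e : ℕ × ℕ × ℕ × ℕ × ℕ =>
      (numB e.1 e.2.1 e.2.2.1 e.2.2.2.1 e.2.2.2.2 : R) *
        (a ^ e.1 * b ^ e.2.1 * c ^ e.2.2.1 * d ^ e.2.2.2.1 * q ^ e.2.2.2.2))
    (qPochInf (-a * q) q * qPochInf (-b * q) q * qPochInf (-c * q) q * qPochInf (-d * q) q)

/-- The five variables of the formal power series. -/
inductive Var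
  | a | b | c | d | q
  deriving DecidableEq

end TenColors

open scoped MvPowerSeries.WithPiTopology

namespace TenColors

/-! A primary part of size `k` is placed at `4k` plus the index of its color, so the primary parts
of positive size are the integers from 4 on. A secondary part stands for the sum of two primary
parts less than 4 apart: `(2i)_xy = i_x + i_y` and `(2i+1)_xy = (i+1)_x + i_y` (`half`,
`merge_spec`).

The bijection behind `A = B` reads distinct primary parts from the largest down and puts each at the
bottom of an increasing list (`build`, `step`). If the new part is too close to a primary part at
the bottom, the two merge into a secondary part `s`. Then `s` climbs: while the next part `p` is
primary with `p.pos < s.pos + 4`, the two cross, `p` losing and `s` gaining one unit (`bubble`).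
Color counts and weight are preserved.

To undo a step, the lowest secondary part is carried back to the bottom, where it becomes `t`
(`unbubble`). If the bottom part is primary and below the upper half of `t`, it was inserted last
without merging; otherwise the last step merged the halves of `t`. If there is no secondary part,
the bottom part came last. Thus the list determines the last inserted part, and inserting a smaller
one is the condition `CanAppend`. Its two cases become the two alternatives of `SecAbove`, which is
stable when both parts are raised. `TripleOK` enters in undoing a crossing: the primary part rises
by 4 and must still fit below the next secondary part. The core is `good_step` and `good_unstep`;
finite checks (`above_iff`, `tripleOK_iff`) turn `Good` into the table and the forbidden patterns.

For the series, sets of distinct primary parts are finite subsets of `ℕ`. Expanding one infinite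
product over `ℕ` and grouping by statistics gives the sum; splitting the same product by residues
modulo 4 gives the four factors. -/

instance : DecidablePred Color.IsPrimary := fun _ => inferInstanceAs (Decidable (_ = _))

/-! ### Positions of parts and halves of secondary parts -/

/-- The index of the first factor of a color. -/
def Color.fst : Color → ℤ
  | .ab | .ac | .ad | .a => 0
  | .bc | .bd | .b => 1
  | .cd | .c => 2
  | .d => 3

/-- The index of the last factor of a color. -/
def Color.snd : Color → ℤ
  | .a => 0
  | .ab | .b => 1
  | .ac | .bc | .c => 2
  | .ad | .bd | .cd | .d => 3

lemma Color.isSecondary_iff (p : Color) : p.IsSecondary ↔ ¬ p.IsPrimary := by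
  cases p <;> simp [Color.IsSecondary, Color.IsPrimary, Color.factors]

lemma Color.eq_of_isPrimary {p : Color} (h : p.IsPrimary) :
    p = .a ∨ p = .b ∨ p = .c ∨ p = .d := by
  revert h
  cases p <;> decide

lemma Color.eq_of_not_isPrimary {p : Color} (h : ¬ p.IsPrimary) :
    p = .ab ∨ p = .ac ∨ p = .ad ∨ p = .bc ∨ p = .bd ∨ p = .cd := by
  revert h
  cases p <;> decide

lemma Color.fst_nonneg (p : Color) : 0 ≤ p.fst := by cases p <;> simp [Color.fst]

lemma Color.snd_le (p : Color) : p.snd ≤ 3 := by cases p <;> simp [Color.snd]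

lemma Color.fst_lt_snd {p : Color} (h : ¬ p.IsPrimary) : p.fst < p.snd := by
  revert h
  cases p <;> simp [Color.fst, Color.snd, Color.IsPrimary, Color.factors]

/-- For a color `xy` the increasing enumeration of the integers that are congruent to the index
of `x` or of `y` modulo `4`. -/
def half (p : Color) (k : ℤ) : ℤ :=
  if k % 2 = 0 then 4 * (k / 2) + p.snd else 4 * ((k + 1) / 2) + p.fst

lemma half_even (p : Color) (i : ℤ) : half p (2 * i) = 4 * i + p.snd := by
  unfold half
  split_ifs <;> omega

lemma half_odd (p : Color) (i : ℤ) : half p (2 * i + 1) = 4 * i + 4 + p.fst := by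
  unfold half
  split_ifs <;> omega

lemma half_even_sub_one (p : Color) (i : ℤ) : half p (2 * i - 1) = 4 * i + p.fst := by
  unfold half
  split_ifs <;> omega

lemma half_add_two (p : Color) (k : ℤ) : half p (k + 2) = half p k + 4 := by
  unfold half
  split_ifs <;> omega

lemma half_lt_succ {p : Color} (h : ¬ p.IsPrimary) (k : ℤ) : half p k < half p (k + 1) := by
  have h1 := Color.fst_lt_snd h
  have h2 := p.fst_nonneg
  have h3 := p.snd_le
  unfold half
  split_ifs <;> omega

lemma half_sub_one_lt {p : Color} (h : ¬ p.IsPrimary) (k : ℤ) : half p (k - 1) < half p k := by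
  simpa using half_lt_succ h (k - 1)

namespace Part

/-- The position of a part, which is its position among the primary parts `1_a, 1_b, ⋯` if it is
primary. -/
def pos (P : Part) : ℤ := 4 * P.size + P.color.fst

/-- The upper of the two primary parts of which a secondary part is made. -/
def up (P : Part) : ℤ := half P.color P.size

/-- The lower of the two primary parts of which a secondary part is made. -/
def dn (P : Part) : ℤ := half P.color (P.size - 1)

/-- Increase the size of a part. -/
def raise (P : Part) : Part := ⟨P.size + 1, P.color⟩

/-- Decrease the size of a part. -/
def lower (P : Part) : Part := ⟨P.size - 1, P.color⟩

/-- The primary parts. -/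
abbrev Prim (P : Part) : Prop := P.color.IsPrimary

/-- The sizes that are allowed for primary and secondary parts. -/
def Valid (P : Part) : Prop := 1 ≤ P.size ∧ (¬ P.Prim → 2 ≤ P.size)

@[simp] lemma raise_color (P : Part) : P.raise.color = P.color := rfl
@[simp] lemma lower_color (P : Part) : P.lower.color = P.color := rfl
@[simp] lemma lower_raise (P : Part) : P.raise.lower = P := rfl

lemma raise_lower {P : Part} (h : 1 ≤ P.size) : P.lower.raise = P := by
  ext
  · simp only [raise, lower]; omega
  · rfl

@[simp] lemma pos_raise (P : Part) : P.raise.pos = P.pos + 4 := by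
  simp [pos, raise]; ring

lemma pos_lower {P : Part} (h : 1 ≤ P.size) : P.lower.pos = P.pos - 4 := by
  simp [pos, lower, h]; ring

-- One more unit moves both halves one term along the sequence `half`: the upper half becomes the
-- lower one, and the old lower half reappears 4 higher.
@[simp] lemma up_raise (P : Part) : P.raise.up = P.dn + 4 := by
  rw [dn, ← half_add_two]; simp [up, raise]; ring_nf

@[simp] lemma dn_raise (P : Part) : P.raise.dn = P.up := by simp [up, dn, raise]

lemma up_lower {P : Part} (h : 1 ≤ P.size) : P.lower.up = P.dn := by
  conv_rhs => rw [← raise_lower h]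
  rw [dn_raise]

lemma dn_lower {P : Part} (h : 1 ≤ P.size) : P.lower.dn = P.up - 4 := by
  conv_rhs => rw [← raise_lower h]
  rw [up_raise]; omega

lemma four_le_pos {P : Part} (h : 1 ≤ P.size) : 4 ≤ P.pos := by
  have := P.color.fst_nonneg
  unfold pos; omega

lemma size_of_pos {P : Part} {n : ℕ} (h : 4 * n ≤ P.pos) : n ≤ P.size := by
  have h1 := P.color.snd_le
  have : P.color.fst ≤ 3 := by cases P.color <;> simp [Color.fst]
  unfold pos at h; omega

lemma dn_lt_up {P : Part} (h : ¬ P.Prim) : P.dn < P.up := half_sub_one_lt h _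

lemma up_lt_dn_add_four {P : Part} (h : ¬ P.Prim) : P.up < P.dn + 4 := by
  rw [dn, ← half_add_two, show (P.size : ℤ) - 1 + 2 = P.size + 1 by ring]
  exact half_lt_succ h _

lemma up_lt_pos {P : Part} (h : ¬ P.Prim) (h2 : 2 ≤ P.size) : P.up < P.pos := by
  have h1 := Color.fst_lt_snd h
  have h3 := P.color.fst_nonneg
  have h4 := P.color.snd_le
  unfold up half pos
  split_ifs <;> omega

lemma dn_add_four_le_pos {P : Part} (h : ¬ P.Prim) (h2 : 2 ≤ P.size) : P.dn + 4 ≤ P.pos := by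
  have h1 := Color.fst_lt_snd h
  have h3 := P.color.fst_nonneg
  have h4 := P.color.snd_le
  unfold dn half pos
  split_ifs <;> omega

/-- If a primary part lies strictly below a secondary one, but not below its upper half, then
the halves of the secondary part have positive size. -/
lemma two_le_size_of_up_le {P : Part} {m : ℤ} (h : ¬ P.Prim) (hm : m < P.pos) (h2 : P.up ≤ m) :
    2 ≤ P.size := by
  have h1 := Color.fst_lt_snd h
  have h3 := P.color.fst_nonneg
  have h4 := P.color.snd_le
  unfold up half at h2
  unfold pos at hm
  split_ifs at h2 <;> omega

end Part

/-! ### Differences between secondary parts -/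

/-- The minimal difference condition for two secondary parts in terms of their halves. -/
def SecAbove (P Q : Part) : Prop := Q.up < P.dn ∨ Q.dn + 4 < P.up

/-- Raising both parts interchanges the two alternatives of `SecAbove`. -/
lemma secAbove_raise {P Q : Part} : SecAbove P.raise Q.raise ↔ SecAbove P Q := by
  simp only [SecAbove, Part.up_raise, Part.dn_raise]; constructor <;> rintro (h | h) <;> omega

lemma SecAbove.of_pos {P Q : Part} (hP : ¬ P.Prim) (hQ : ¬ Q.Prim) (h : Q.pos + 4 < P.pos) :
    SecAbove P Q := by
  have h1 := Color.fst_lt_snd hP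
  have h2 := Color.fst_lt_snd hQ
  have h3 := P.color.fst_nonneg
  have h4 := P.color.snd_le
  have h5 := Q.color.fst_nonneg
  have h6 := Q.color.snd_le
  unfold SecAbove Part.up Part.dn half
  unfold Part.pos at h
  split_ifs <;> omega

lemma SecAbove.up_add_four_lt {P Q : Part} (hP : ¬ P.Prim) (hQ : ¬ Q.Prim) (hP2 : 2 ≤ P.size)
    (hQ2 : 2 ≤ Q.size) (h : SecAbove P Q) : Q.up + 4 < P.pos := by
  have h1 := Color.fst_lt_snd hP
  have h2 := Color.fst_lt_snd hQ
  have h3 := P.color.fst_nonneg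
  have h4 := P.color.snd_le
  have h5 := Q.color.fst_nonneg
  have h6 := Q.color.snd_le
  unfold SecAbove Part.up Part.dn half at h
  unfold Part.pos Part.up half
  split_ifs at * <;> omega

lemma secAbove_iff_minDiff {P Q : Part} (hP : ¬ P.Prim) (hQ : ¬ Q.Prim) :
    SecAbove P Q ↔ Q.size + minDiff P.color Q.color ≤ P.size := by
  obtain ⟨k, p⟩ := P
  obtain ⟨l, q⟩ := Q
  simp only [SecAbove, Part.up, Part.dn, minDiff]
  zify
  generalize (k : ℤ) = k
  generalize (l : ℤ) = l
  rcases k.even_or_odd' with ⟨i, rfl | rfl⟩ <;> rcases l.even_or_odd' with ⟨j, rfl | rfl⟩ <;>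
    simp only [half_even, half_odd, half_even_sub_one, add_sub_cancel_right] <;>
    rcases Color.eq_of_not_isPrimary hP with h | h | h | h | h | h <;>
    rcases Color.eq_of_not_isPrimary hQ with h' | h' | h' | h' | h' | h' <;>
    simp only at h h' <;> subst h <;> subst h' <;>
    simp only [Color.fst, Color.snd, Color.rank, minDiffTable, Matrix.of_apply,
      Matrix.cons_val] <;> omega

lemma minDiff_add_minDiff {p q r : Color} (hp : ¬ p.IsPrimary) (hq : ¬ q.IsPrimary)
    (hr : ¬ r.IsPrimary) : r.fst + 8 ≤ 4 * (minDiff p q + minDiff q r) + p.fst := by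
  revert hp hq hr
  cases p <;> cases q <;> cases r <;> decide

/-- A single difference can be as small as 0, but any two successive entries of the table add up to
enough. This yields `TripleOK` in `Good.replace_head`. -/
lemma SecAbove.add_eight_le {P Q R : Part} (hP : ¬ P.Prim) (hQ : ¬ Q.Prim) (hR : ¬ R.Prim)
    (h : SecAbove P Q) (h' : SecAbove Q R) : R.pos + 8 ≤ P.pos := by
  rw [secAbove_iff_minDiff hP hQ] at h
  rw [secAbove_iff_minDiff hQ hR] at h'
  have := minDiff_add_minDiff hP hQ hR
  unfold Part.pos
  zify at h h'
  linarith

/-! ### Merging and splitting -/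

/-- The secondary color made of two different primary ones. -/
def Color.join : Color → Color → Color
  | .a, .b | .b, .a => .ab
  | .a, .c | .c, .a => .ac
  | .a, .d | .d, .a => .ad
  | .b, .c | .c, .b => .bc
  | .b, .d | .d, .b => .bd
  | .c, .d | .d, .c => .cd
  | p, _ => p

/-- The secondary part made of two primary ones. -/
def Part.merge (x y : Part) : Part := ⟨x.size + y.size, x.color.join y.color⟩

/-- A distance strictly between 0 and 4 forces different colors. Either the sizes agree and `x` has
the smaller color (even sum), or `y` is one larger and has the smaller color (odd sum). -/
lemma Part.merge_spec {x y : Part} (hx : x.Prim) (hy : y.Prim) (h : x.pos < y.pos)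
    (h' : y.pos < x.pos + 4) : ¬ (x.merge y).Prim ∧ (x.merge y).dn = x.pos ∧
      (x.merge y).up = y.pos ∧
      (x.merge y).color.factors.Perm (x.color.factors ++ y.color.factors) := by
  obtain ⟨k, p⟩ := x
  obtain ⟨l, q⟩ := y
  simp only [merge, pos, Part.up, Part.dn, half, Part.Prim] at *
  rcases Color.eq_of_isPrimary hx with rfl | rfl | rfl | rfl <;>
    rcases Color.eq_of_isPrimary hy with rfl | rfl | rfl | rfl <;>
    simp only [Color.fst, Color.snd, Color.join] at * <;>
    first
    | (exfalso; omega)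
    | refine ⟨by decide, ?_, ?_, by decide⟩ <;> split_ifs <;> push_cast at * <;> omega

/-- The color `x` of a color `xy` or `x`. -/
def Color.first : Color → Color
  | .ab | .ac | .ad | .a => .a
  | .bc | .bd | .b => .b
  | .cd | .c => .c
  | .d => .d

/-- The color `y` of a color `xy` or `y`. -/
def Color.last : Color → Color
  | .a => .a
  | .ab | .b => .b
  | .ac | .bc | .c => .c
  | .ad | .bd | .cd | .d => .d

/-- The upper primary part of which a secondary part is made. -/
def Part.upPart (s : Part) : Part :=
  ⟨(s.size + 1) / 2, if s.size % 2 = 0 then s.color.last else s.color.first⟩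

/-- The lower primary part of which a secondary part is made. -/
def Part.dnPart (s : Part) : Part :=
  ⟨s.size / 2, if s.size % 2 = 0 then s.color.first else s.color.last⟩

lemma Part.upPart_spec {s : Part} (hs : ¬ s.Prim) : s.upPart.Prim ∧ s.upPart.pos = s.up := by
  obtain ⟨k, p⟩ := s
  simp only [upPart, pos, Part.up, half, Part.Prim] at *
  rcases Color.eq_of_not_isPrimary hs with rfl | rfl | rfl | rfl | rfl | rfl <;>
    simp only [Color.first, Color.last] <;>
    constructor <;> split_ifs <;>
    first | decide | (simp only [Color.fst, Color.snd]; push_cast at *; omega)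

lemma Part.dnPart_spec {s : Part} (hs : ¬ s.Prim) : s.dnPart.Prim ∧ s.dnPart.pos = s.dn := by
  obtain ⟨k, p⟩ := s
  simp only [dnPart, pos, Part.dn, half, Part.Prim] at *
  rcases Color.eq_of_not_isPrimary hs with rfl | rfl | rfl | rfl | rfl | rfl <;>
    simp only [Color.first, Color.last] <;>
    constructor <;> split_ifs <;>
    first | decide | (simp only [Color.fst, Color.snd]; push_cast at *; omega)

lemma Part.merge_halves {s : Part} (hs : ¬ s.Prim) : s.dnPart.merge s.upPart = s := by
  obtain ⟨k, p⟩ := s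
  simp only [dnPart, upPart, merge, Part.mk.injEq]
  refine ⟨by omega, ?_⟩
  rcases Color.eq_of_not_isPrimary hs with h | h | h | h | h | h <;>
    simp only at h <;> subst h <;> split_ifs <;> rfl

lemma Part.eq_of_pos {x y : Part} (hx : x.Prim) (hy : y.Prim) (h : x.pos = y.pos) : x = y := by
  obtain ⟨k, p⟩ := x
  obtain ⟨l, q⟩ := y
  simp only [pos] at h
  rcases Color.eq_of_isPrimary hx with h' | h' | h' | h' <;>
    rcases Color.eq_of_isPrimary hy with h'' | h'' | h'' | h'' <;>
    simp only at h' h'' <;> subst h' <;> subst h'' <;> simp only [Color.fst] at h <;>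
    first
    | (exfalso; omega)
    | rw [Part.mk.injEq]; exact ⟨by omega, rfl⟩

/-! ### Difference conditions on increasing sequences -/

open TenColors.Part

/-- The minimal difference condition for a part `P` followed by the part `Q`. -/
def Above (P Q : Part) : Prop :=
  (P.Prim → Q.pos + 4 ≤ P.pos) ∧
    (¬ P.Prim → (Q.Prim → Q.pos + 4 < P.pos) ∧ (¬ Q.Prim → SecAbove P Q))

/-- The condition that expresses that `S, P, Q` is not a forbidden pattern. -/
def TripleOK (Q P S : Part) : Prop :=
  Q.Prim → ¬ P.Prim → ¬ S.Prim → P.dn ≤ Q.pos → Q.pos + 8 < S.pos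

/-- The condition on the first three parts of an increasing sequence. -/
def HeadOK : List Part → Prop
  | Q :: P :: S :: _ => TripleOK Q P S
  | _ => True

/-- The increasing rearrangements of the partitions with difference conditions. -/
def Good : List Part → Prop
  | [] => True
  | [P] => P.Valid
  | Q :: P :: M => Q.Valid ∧ Above P Q ∧ HeadOK (Q :: P :: M) ∧ Good (P :: M)

lemma headOK_of_prim {Q P : Part} {M : List Part} (h : P.Prim) : HeadOK (Q :: P :: M) := by
  cases M
  · trivial
  · exact fun _ h' => absurd h h'

lemma headOK_of_not_prim {Q : Part} {M : List Part} (h : ¬ Q.Prim) : HeadOK (Q :: M) := by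
  rcases M with _ | ⟨_, _ | _⟩
  · trivial
  · trivial
  · exact fun h' => absurd h' h

lemma Good.valid {P : Part} {M : List Part} (h : Good (P :: M)) : P.Valid := by
  cases M
  · exact h
  · exact h.1

lemma Good.tail {P : Part} {M : List Part} (h : Good (P :: M)) : Good M := by
  cases M
  · trivial
  · exact h.2.2.2

/-! ### Crossings, insertion and removal -/

/-- Insert a secondary part below an increasing sequence, crossing it with the primary parts that
are too close. -/
def bubble : Part → List Part → List Part
  | s, [] => [s]
  | s, p :: M =>
    if p.Prim ∧ p.pos < s.pos + 4 then p.lower :: bubble s.raise M else s :: p :: M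

/-- Take the lowest secondary part out of an increasing sequence, crossing it with all the primary
parts below it. -/
def unbubble : List Part → Option (Part × List Part)
  | [] => none
  | p :: M =>
    if p.Prim then (unbubble M).map fun r => (r.1.lower, p.raise :: r.2) else some (p, M)

/-- Append a smaller primary part to an increasing sequence, merging it with its successor if
both are too close. -/
def step (x : Part) : List Part → List Part
  | [] => [x]
  | y :: M => if y.Prim ∧ y.pos < x.pos + 4 then bubble (x.merge y) M else x :: y :: M

/-- The inverse of `step`. -/
def unstep (M : List Part) : Option (Part × List Part) :=
  match M with
  | [] => none
  | p :: M' =>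
    match unbubble (p :: M') with
    | none => some (p, M')
    | some r =>
      if p.Prim ∧ p.pos < r.1.up then some (p, M') else some (r.1.dnPart, r.1.upPart :: r.2)

lemma bubble_ne_nil (s : Part) (M : List Part) : bubble s M ≠ [] := by
  cases M <;> simp [bubble]
  split_ifs <;> simp

lemma unbubble_not_prim {M N : List Part} {t : Part} (h : unbubble M = some (t, N)) :
    ¬ t.Prim := by
  induction M generalizing t N with
  | nil => simp [unbubble] at h
  | cons p M ih =>
    unfold unbubble at h
    split_ifs at h with hp
    · cases hM : unbubble M with
      | none => simp [hM] at h
      | some r =>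
        simp only [hM, Option.map_some, Option.some.injEq, Prod.mk.injEq] at h
        rw [← h.1]
        exact ih (t := r.1) (N := r.2) hM
    · simp only [Option.some.injEq, Prod.mk.injEq] at h
      exact h.1 ▸ hp

lemma unbubble_cons_prim {p : Part} (hp : p.Prim) {M N : List Part} {t : Part}
    (h : unbubble (p :: M) = some (t, N)) :
    ∃ r N', unbubble M = some (r, N') ∧ t = r.lower ∧ N = p.raise :: N' := by
  simp only [unbubble, hp, if_true, Option.map_eq_some_iff] at h
  obtain ⟨r, h1, h2⟩ := h
  simp only [Prod.mk.injEq] at h2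
  exact ⟨r.1, r.2, h1, h2.1.symm, h2.2.symm⟩

lemma unbubble_cons_not_prim {p : Part} (hp : ¬ p.Prim) (M : List Part) :
    unbubble (p :: M) = some (p, M) := by simp [unbubble, hp]

/-- All parts crossed by `s` are primary, so `s` ends up as the lowest secondary part and the way
back undoes exactly these crossings. -/
lemma unbubble_bubble {s : Part} (hs : ¬ s.Prim) {M : List Part} (hM : ∀ p ∈ M, 1 ≤ p.size) :
    unbubble (bubble s M) = some (s, M) := by
  induction M generalizing s with
  | nil => simp [bubble, unbubble, hs]
  | cons p M ih =>
    simp only [List.mem_cons, forall_eq_or_imp] at hM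
    unfold bubble
    split_ifs with h
    · have hr : ¬ s.raise.Prim := hs
      have hl : p.lower.Prim := h.1
      simp [unbubble, hl, ih hr hM.2, raise_lower hM.1]
    · exact unbubble_cons_not_prim hs _

lemma Good.one_le_size {M : List Part} (h : Good M) : ∀ p ∈ M, 1 ≤ p.size := by
  induction M with
  | nil => simp
  | cons p M ih =>
    simp only [List.mem_cons, forall_eq_or_imp]
    exact ⟨h.valid.1, ih h.tail⟩

/-- Each crossing lowers the secondary part by 4, and consecutive primary parts are at least 4
apart, so the strict gap survives on the way down. -/
lemma Good.pos_lt_of_unbubble {p : Part} (hp : p.Prim) {M N : List Part} {t : Part}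
    (hM : Good (p :: M)) (h : unbubble M = some (t, N)) : p.pos + 4 < t.pos := by
  induction M generalizing t N p with
  | nil => simp [unbubble] at h
  | cons q M ih =>
    have hA := hM.2.1
    by_cases hq : q.Prim
    · obtain ⟨r, N', h1, rfl, rfl⟩ := unbubble_cons_prim hq h
      have h2 := ih hq hM.tail h1
      have h3 := hA.1 hq
      have h4 := four_le_pos hM.valid.1
      have : 1 ≤ r.size := size_of_pos (by omega)
      rw [pos_lower this]; omega
    · rw [unbubble_cons_not_prim hq] at h
      simp only [Option.some.injEq, Prod.mk.injEq] at h
      rw [← h.1]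
      exact (hA.2 hq).1 hp

lemma Good.two_le_of_unbubble {p : Part} (hp : p.Prim) {M N : List Part} {t : Part}
    (hM : Good (p :: M)) (h : unbubble M = some (t, N)) : 2 ≤ t.size := by
  have h1 := hM.pos_lt_of_unbubble hp h
  have h2 := four_le_pos hM.valid.1
  exact size_of_pos (by omega)

lemma secAbove_lower {P Q : Part} (hP : 1 ≤ P.size) (h : SecAbove P.lower Q) :
    SecAbove P Q.raise := by
  rw [← raise_lower hP]
  exact secAbove_raise.2 h

/-- The hypotheses form an invariant of the climb: `hR` compares `s` with the next secondary part
brought down to the same place, and `hp` keeps the next primary part 4 above the upper half of `s`.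
-/
lemma good_bubble {s : Part} (hs : ¬ s.Prim) (hs2 : 2 ≤ s.size) {M : List Part} (hM : Good M)
    (hR : ∀ t N, unbubble M = some (t, N) → SecAbove t s)
    (hp : ∀ p ∈ M.head?, p.Prim → s.up + 4 ≤ p.pos) : Good (bubble s M) := by
  have hsv : s.Valid := ⟨by omega, fun _ => hs2⟩
  induction M generalizing s with
  | nil => exact hsv
  | cons p M ih =>
    have hp1 := hp p (by simp)
    unfold bubble
    split_ifs with hc
    · obtain ⟨hpp, hc⟩ := hc
      -- With `hp1` this puts `p` at position 8 or more, so `p.lower` still has positive size.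
      have hs1 : 4 ≤ s.up := by
        have h1 := Color.fst_lt_snd hs
        have h2 := s.color.fst_nonneg
        unfold up half
        split_ifs <;> omega
      have hp2 := hp1 hpp
      have hpl : p.lower.Prim := hpp
      have hpv : p.lower.Valid := by
        refine ⟨?_, fun h => absurd hpp h⟩
        have : 2 ≤ p.size := size_of_pos (by omega)
        simp only [lower]; omega
      have hpos := pos_lower hM.valid.1
      have hsr : ¬ s.raise.Prim := hs
      have hud := dn_lt_up hs
      have key : Good (bubble s.raise M) := by
        refine ih hsr (by simp only [raise]; omega) hM.tail ?_ ?_ ⟨?_, ?_⟩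
        · intro t N h
          -- Passing below `p` turns `t` into `t.lower`, which `hR` compares with `s`; raising both
          -- gives the claim.
          have h2 := hM.two_le_of_unbubble hpp h
          refine secAbove_lower (by omega) (hR t.lower (p.raise :: N) ?_)
          simp [unbubble, hpp, h]
        · intro q hq hqp
          cases M with
          | nil => simp at hq
          | cons q' M =>
            simp only [List.head?_cons, Option.mem_def, Option.some.injEq] at hq
            subst hq
            have := hM.2.1.1 hqp
            rw [up_raise]; omega
        · simp only [raise]; omega
        · intro; simp only [raise]; omega
      cases M with
      | nil =>
        refine ⟨hpv, ⟨fun h => absurd h hsr, fun _ => ⟨fun _ => ?_, fun h => absurd hpl h⟩⟩,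
          trivial, key⟩
        rw [pos_raise]; omega
      | cons q M =>
        unfold bubble at key ⊢
        split_ifs at key ⊢ with hq
        · have := hM.2.1.1 hq.1
          have hql : q.lower.Prim := hq.1
          have hqpos := pos_lower hM.tail.valid.1
          exact ⟨hpv, ⟨fun _ => by omega, fun h => absurd hql h⟩, headOK_of_prim hql, key⟩
        · refine ⟨hpv, ⟨fun h => absurd h hsr, fun _ => ⟨fun _ => ?_, fun h => absurd hpl h⟩⟩,
            fun _ _ hqs _ => ?_, key⟩
          · rw [pos_raise]; omega
          -- `TripleOK` for `p.lower`, `s.raise`, `q`: more than 4 above `p` is more than 8 above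
          -- `p.lower`.
          · have := (hM.2.1.2 hqs).1 hpp
            omega
    · refine ⟨hsv, ⟨fun h => ?_, fun h => ⟨fun h' => absurd h' hs, fun _ => ?_⟩⟩,
        headOK_of_not_prim hs, hM⟩
      · by_contra h'
        exact hc ⟨h, by omega⟩
      · exact hR p M (unbubble_cons_not_prim h _)

/-! ### Insertion is reversible -/

/-- The primary part `x` may be appended to the sequence. -/
def CanAppend (x : Part) (M : List Part) : Prop :=
  ∀ r, unstep M = some r → x.pos < r.1.pos

lemma unstep_of_none {p : Part} {M : List Part} (h : unbubble (p :: M) = none) :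
    unstep (p :: M) = some (p, M) := by
  simp [unstep, h]

lemma unstep_of_lt {p t : Part} {M N : List Part} (h : unbubble (p :: M) = some (t, N))
    (hp : p.Prim) (h' : p.pos < t.up) : unstep (p :: M) = some (p, M) := by
  simp [unstep, h, hp, h']

lemma unstep_of_not {p t : Part} {M N : List Part} (h : unbubble (p :: M) = some (t, N))
    (h' : p.Prim → t.up ≤ p.pos) : unstep (p :: M) = some (t.dnPart, t.upPart :: N) := by
  simp only [unstep, h]
  rw [if_neg]
  rintro ⟨h1, h2⟩
  exact absurd (h' h1) (by omega)

/-- `step` preserves the difference conditions, and `unstep` undoes it. -/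
theorem good_step {x : Part} {M : List Part} (hx : x.Prim) (hx1 : 1 ≤ x.size) (hM : Good M)
    (h : CanAppend x M) : Good (step x M) ∧ unstep (step x M) = some (x, M) := by
  have hxv : x.Valid := ⟨hx1, fun h => absurd hx h⟩
  have hu : ∀ {L}, unbubble L = none → unbubble (x :: L) = none := by
    intro L hL; simp [unbubble, hx, hL]
  have hu' : ∀ {L t N}, unbubble L = some (t, N) →
      unbubble (x :: L) = some (t.lower, x.raise :: N) := by
    intro L t N hL; simp [unbubble, hx, hL]
  cases M with
  | nil => exact ⟨hxv, unstep_of_none (hu rfl)⟩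
  | cons y M =>
    by_cases hy : y.Prim
    · -- the relation between `x`, `y` and the lowest secondary part
      have key : x.pos < y.pos ∧ ∀ t N, unbubble M = some (t, N) →
          y.pos < t.dn ∨ x.pos + 4 < t.up := by
        cases hb : unbubble M with
        | none =>
          have := h _ (unstep_of_none (by simp [unbubble, hy, hb]))
          simp [this]
        | some r =>
          obtain ⟨t, N⟩ := r
          have ht := unbubble_not_prim hb
          have ht2 := hM.two_le_of_unbubble hy hb
          have hb' : unbubble (y :: M) = some (t.lower, y.raise :: N) := by
            simp [unbubble, hy, hb]
          have hul := up_lower (P := t) (by omega)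
          have hdl := dn_lower (P := t) (by omega)
          have htl : ¬ t.lower.Prim := ht
          have hud := dn_lt_up htl
          simp only [Option.some.injEq, Prod.mk.injEq]
          -- Either `y` was inserted last, and `hlt` itself is the first alternative because
          -- `t.lower.up = t.dn`; or the halves of `t.lower` were merged last, and `x.pos <
          -- t.lower.dn = t.up - 4` is the second.
          by_cases hlt : y.pos < t.lower.up
          · have := h _ (unstep_of_lt hb' hy hlt)
            refine ⟨this, ?_⟩
            rintro t' N' ⟨rfl, -⟩
            left; omega
          · have := h _ (unstep_of_not hb' (fun _ => by omega))
            simp only [(dnPart_spec htl).2] at this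
            refine ⟨by omega, ?_⟩
            rintro t' N' ⟨rfl, -⟩
            right; omega
      obtain ⟨hxy, key⟩ := key
      by_cases hc : y.pos < x.pos + 4
      · obtain ⟨hs, hdn, hup, -⟩ := merge_spec hx hy hxy hc
        have hsize : 2 ≤ (x.merge y).size := by
          have := hM.valid.1
          simp only [Part.merge]; omega
        have hstep : step x (y :: M) = bubble (x.merge y) M := by simp [step, hy, hc]
        have hhead : ∀ p ∈ M.head?, p.Prim → (x.merge y).up + 4 ≤ p.pos := by
          intro p hp hpp
          cases M with
          | nil => simp at hp
          | cons p' M =>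
            simp only [List.head?_cons, Option.mem_def, Option.some.injEq] at hp
            subst hp
            rw [hup]
            exact hM.2.1.1 hpp
        rw [hstep]
        refine ⟨good_bubble hs hsize hM.tail ?_ hhead, ?_⟩
        · intro t N hb
          rcases key t N hb with h | h
          · left; rwa [hup]
          · right; rwa [hdn]
        · have hub := unbubble_bubble hs hM.tail.one_le_size
          have hdp : (x.merge y).dnPart = x :=
            eq_of_pos (dnPart_spec hs).1 hx ((dnPart_spec hs).2.trans hdn)
          have hupp : (x.merge y).upPart = y :=
            eq_of_pos (upPart_spec hs).1 hy ((upPart_spec hs).2.trans hup)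
          cases hB : bubble (x.merge y) M with
          | nil => exact absurd hB (bubble_ne_nil _ _)
          | cons p L =>
            rw [hB] at hub
            rw [unstep_of_not hub, hdp, hupp]
            intro hpp
            cases M with
            | nil =>
              simp only [bubble, List.cons.injEq] at hB
              exact absurd (hB.1 ▸ hpp) hs
            | cons q M =>
              unfold bubble at hB
              split_ifs at hB with hq
              · simp only [List.cons.injEq] at hB
                have := hhead q (by simp) hq.1
                rw [← hB.1, pos_lower hM.tail.valid.1]; omega
              · simp only [List.cons.injEq] at hB
                exact absurd (hB.1 ▸ hpp) hs
      · have hstep : step x (y :: M) = x :: y :: M := by simp [step, hc]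
        rw [hstep]
        refine ⟨⟨hxv, ⟨fun _ => by omega, fun h => absurd hy h⟩, headOK_of_prim hy, hM⟩, ?_⟩
        cases hb : unbubble M with
        | none => exact unstep_of_none (hu (by simp [unbubble, hy, hb]))
        | some r =>
          obtain ⟨t, N⟩ := r
          have ht := unbubble_not_prim hb
          have ht2 := hM.two_le_of_unbubble hy hb
          have hb' : unbubble (y :: M) = some (t.lower, y.raise :: N) := by
            simp [unbubble, hy, hb]
          -- Carried below both `y` and `x`, the secondary part `t` has its upper half at `t.up -
          -- 4`.
          refine unstep_of_lt (hu' hb') hx ?_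
          have hts : t.lower.size = t.size - 1 := rfl
          rw [up_lower (by omega), dn_lower (by omega)]
          have := dn_lt_up ht
          have := up_lt_dn_add_four ht
          rcases key t N hb with h | h <;> omega
    · have hstep : step x (y :: M) = x :: y :: M := by simp [step, hy]
      have hb := unbubble_cons_not_prim hy M
      have hlt := h _ (unstep_of_not hb (fun h => absurd h hy))
      simp only [(dnPart_spec hy).2] at hlt
      have hy2 := hM.valid.2 hy
      have := dn_add_four_le_pos hy hy2
      rw [hstep]
      refine ⟨⟨hxv, ⟨fun h => absurd h hy, fun _ => ⟨fun _ => by omega, fun h => absurd hx h⟩⟩,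
        ?_, hM⟩, unstep_of_lt (hu' hb) hx ?_⟩
      -- `TripleOK` holds vacuously, since `x` lies below `y.dn`.
      · cases M
        · trivial
        · intro _ _ _ h
          omega
      · rwa [up_lower (by omega)]

/-! ### Removal is reversible -/

/-- If primary parts lie in between, then `r` is still more than 4 above `s` after crossing them,
and `SecAbove.of_pos` applies. -/
lemma Good.secAbove_of_unbubble {s : Part} (hs : ¬ s.Prim) {M N : List Part} {r : Part}
    (hM : Good (s :: M)) (h : unbubble M = some (r, N)) : SecAbove r s := by
  cases M with
  | nil => simp [unbubble] at h
  | cons q M =>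
    have hr := unbubble_not_prim h
    by_cases hq : q.Prim
    · obtain ⟨t, N', h1, rfl, rfl⟩ := unbubble_cons_prim hq h
      have h2 := hM.tail.pos_lt_of_unbubble hq h1
      have h3 := hM.tail.two_le_of_unbubble hq h1
      have h4 := hM.2.1.1 hq
      refine SecAbove.of_pos hr hs ?_
      rw [pos_lower (by omega)]; omega
    · rw [unbubble_cons_not_prim hq] at h
      simp only [Option.some.injEq, Prod.mk.injEq] at h
      rw [← h.1]
      exact (hM.2.1.2 hq).2 hs

/-- A secondary part at the bottom may be replaced with a primary part below it. -/
lemma Good.replace_head {s z : Part} (hs : ¬ s.Prim) (hz : z.Prim) (hz1 : 1 ≤ z.size)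
    {M : List Part} (hM : Good (s :: M)) (h : z.pos < s.pos)
    (h' : ∀ q ∈ M.head?, ¬ q.Prim → z.pos + 4 < q.pos) : Good (z :: M) := by
  have hzv : z.Valid := ⟨hz1, fun h => absurd hz h⟩
  cases M with
  | nil => exact hzv
  | cons q M =>
    have hA := hM.2.1
    refine ⟨hzv, ⟨fun hq => ?_, fun hq => ⟨fun _ => h' q (by simp) hq, fun h => absurd hz h⟩⟩,
      ?_, hM.tail⟩
    · have := hA.1 hq
      omega
    · cases M with
      | nil => trivial
      | cons S M =>
        intro _ hq hS _
        have h1 := (hA.2 hq).2 hs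
        have h2 := (hM.tail.2.1.2 hS).2 hq
        have := h2.add_eight_le hS hq hs h1
        omega

/-- The case in which the last step was a merge, as expressed by `hp`. The conclusions are what
`good_unstep` needs to split `t` and keep the upper half in the list. -/
lemma Good.unbubble_spec {M N : List Part} {t : Part} (hM : Good M)
    (h : unbubble M = some (t, N)) (hp : ∀ p ∈ M.head?, p.Prim → t.up ≤ p.pos) :
    2 ≤ t.size ∧ bubble t N = M ∧ Good (t.upPart :: N) ∧
      ∀ r N', unbubble N = some (r, N') → SecAbove r t := by
  induction M generalizing t N with
  | nil => simp [unbubble] at h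
  | cons p M ih =>
    have ht := unbubble_not_prim h
    obtain ⟨hup1, hup2⟩ := upPart_spec ht
    by_cases hpp : p.Prim
    · have hp1 := hp p (by simp) hpp
      obtain ⟨t, N, h1, rfl, rfl⟩ := unbubble_cons_prim hpp h
      have htt := unbubble_not_prim h1
      have h2 := hM.pos_lt_of_unbubble hpp h1
      have h3 := hM.two_le_of_unbubble hpp h1
      have hpl := pos_lower (P := t) (by omega)
      have hul := up_lower (P := t) (by omega)
      -- A secondary part of size 1 has its upper half at its own position, which leaves no room for
      -- `p` in between.
      have htl2 : 2 ≤ t.lower.size := two_le_size_of_up_le ht (m := p.pos) (by omega) hp1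
      have hupv : 1 ≤ t.lower.upPart.size := by
        simp only [upPart]; omega
      have hhead : ∀ q ∈ M.head?, q.Prim → t.up ≤ q.pos := by
        intro q hq hqp
        cases M with
        | nil => simp at hq
        | cons q' M =>
          simp only [List.head?_cons, Option.mem_def, Option.some.injEq] at hq
          subst hq
          have := hM.2.1.1 hqp
          have := up_lt_dn_add_four htt
          omega
      obtain ⟨-, i2, i3, i4⟩ := ih hM.tail h1 hhead
      have hpr : p.raise.Prim := hpp
      refine ⟨htl2, ?_, ?_, ?_⟩
      · unfold bubble
        rw [if_pos ⟨hpr, by rw [pos_raise]; omega⟩, lower_raise, raise_lower (by omega), i2]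
      · have hg : Good (p.raise :: N) := by
          cases M with
          | nil => simp [unbubble] at h1
          | cons q M =>
            by_cases hq : q.Prim
            · obtain ⟨t', N', h1', rfl, rfl⟩ := unbubble_cons_prim hq h1
              have hqr : q.raise.Prim := hq
              have := hM.2.1.1 hq
              refine ⟨⟨by simp [raise], fun h => absurd hpp h⟩, ⟨fun _ => ?_,
                fun h => absurd hqr h⟩, headOK_of_prim hqr, i3.tail⟩
              simp only [pos_raise]; omega
            · rw [unbubble_cons_not_prim hq] at h1
              simp only [Option.some.injEq, Prod.mk.injEq] at h1
              obtain ⟨rfl, rfl⟩ := h1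
              refine hM.tail.replace_head hq hpr (by simp [raise]) (by rw [pos_raise]; omega) ?_
              intro S hS hSp
              cases M with
              | nil => simp at hS
              | cons S' M =>
                simp only [List.head?_cons, Option.mem_def, Option.some.injEq] at hS
                subst hS
                -- The use of `TripleOK`: `p.raise` must fit below the next secondary part `S`.
                have := hM.2.2.1 hpp hq hSp (by omega)
                rw [pos_raise]; omega
        refine ⟨⟨hupv, fun h => absurd hup1 h⟩, ⟨fun _ => ?_, fun h => absurd hpr h⟩,
          headOK_of_prim hpr, hg⟩
        rw [hup2, pos_raise]; omega
      · intro r N' hr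
        obtain ⟨r, N', h5, rfl, rfl⟩ := unbubble_cons_prim hpr hr
        have h6 := i3.two_le_of_unbubble (upPart_spec htt).1 h5
        rw [← secAbove_raise, raise_lower (by omega), raise_lower (by omega)]
        exact i4 r N' h5
    · rw [unbubble_cons_not_prim hpp] at h
      simp only [Option.some.injEq, Prod.mk.injEq] at h
      obtain ⟨rfl, rfl⟩ := h
      have hp2 := hM.valid.2 hpp
      have hlt := up_lt_pos hpp hp2
      refine ⟨hp2, ?_, ?_, fun r N' hr => hM.secAbove_of_unbubble hpp hr⟩
      · cases M with
        | nil => rfl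
        | cons q M =>
          unfold bubble
          rw [if_neg]
          rintro ⟨hq, h⟩
          have := hM.2.1.1 hq
          omega
      · refine hM.replace_head hpp hup1 (by simp only [upPart]; omega) (by omega) ?_
        intro q hq hqp
        cases M with
        | nil => simp at hq
        | cons q' M =>
          simp only [List.head?_cons, Option.mem_def, Option.some.injEq] at hq
          subst hq
          rw [hup2]
          exact ((hM.2.1.2 hqp).2 hpp).up_add_four_lt hqp hpp (hM.tail.valid.2 hqp) hp2

/-- `unstep` preserves the difference conditions, and `step` undoes it. -/
theorem good_unstep {x : Part} {M L : List Part} (hM : Good M) (h : unstep M = some (x, L)) :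
    x.Prim ∧ 1 ≤ x.size ∧ Good L ∧ CanAppend x L ∧ step x L = M := by
  cases M with
  | nil => simp [unstep] at h
  | cons p M =>
    cases hb : unbubble (p :: M) with
    | none =>
      rw [unstep_of_none hb] at h
      simp only [Option.some.injEq, Prod.mk.injEq] at h
      obtain ⟨rfl, rfl⟩ := h
      have hp : p.Prim := by
        by_contra hp
        rw [unbubble_cons_not_prim hp] at hb
        simp at hb
      have hb' : unbubble M = none := by simpa [unbubble, hp] using hb
      refine ⟨hp, hM.valid.1, hM.tail, ?_, ?_⟩
      · intro r hr
        cases M with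
        | nil => simp [unstep] at hr
        | cons q M =>
          rw [unstep_of_none hb', Option.some.injEq] at hr
          subst hr
          have hq : q.Prim := by
            by_contra hq
            rw [unbubble_cons_not_prim hq] at hb'
            simp at hb'
          have := hM.2.1.1 hq
          simp only; omega
      · cases M with
        | nil => rfl
        | cons q M =>
          refine if_neg ?_
          rintro ⟨hq, h⟩
          have := hM.2.1.1 hq
          omega
    | some r =>
      obtain ⟨t, N⟩ := r
      have ht := unbubble_not_prim hb
      by_cases hc : p.Prim ∧ p.pos < t.up
      · obtain ⟨hp, hc⟩ := hc
        rw [unstep_of_lt hb hp hc] at h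
        simp only [Option.some.injEq, Prod.mk.injEq] at h
        obtain ⟨rfl, rfl⟩ := h
        obtain ⟨t, N, h1, rfl, rfl⟩ := unbubble_cons_prim hp hb
        have ht2 := hM.two_le_of_unbubble hp h1
        rw [up_lower (by omega)] at hc
        have htt := unbubble_not_prim h1
        refine ⟨hp, hM.valid.1, hM.tail, ?_, ?_⟩
        · intro r hr
          cases M with
          | nil => simp [unstep] at hr
          | cons q M =>
            by_cases hq : q.Prim ∧ q.pos < t.up
            · rw [unstep_of_lt h1 hq.1 hq.2, Option.some.injEq] at hr
              subst hr
              have := hM.2.1.1 hq.1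
              simp only; omega
            · rw [unstep_of_not h1 (by simpa using hq), Option.some.injEq] at hr
              subst hr
              simpa only [(dnPart_spec htt).2] using hc
        · cases M with
          | nil => rfl
          | cons q M =>
            refine if_neg ?_
            rintro ⟨hq, h⟩
            have := hM.2.1.1 hq
            omega
      · have hc' : p.Prim → t.up ≤ p.pos := by simpa using hc
        rw [unstep_of_not hb hc'] at h
        simp only [Option.some.injEq, Prod.mk.injEq] at h
        obtain ⟨rfl, rfl⟩ := h
        obtain ⟨h1, h2, h3, h4⟩ := hM.unbubble_spec hb (by simpa using hc')
        obtain ⟨hup1, hup2⟩ := upPart_spec ht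
        obtain ⟨hdn1, hdn2⟩ := dnPart_spec ht
        have hlt := dn_lt_up ht
        refine ⟨hdn1, by simp only [dnPart]; omega, h3, ?_, ?_⟩
        · intro r hr
          cases hN : unbubble N with
          | none =>
            rw [unstep_of_none (by simp [unbubble, hup1, hN]), Option.some.injEq] at hr
            subst hr
            simp only; omega
          | some q =>
            obtain ⟨q, N'⟩ := q
            have hq := unbubble_not_prim hN
            have hq2 := h3.two_le_of_unbubble hup1 hN
            have hN' : unbubble (t.upPart :: N) = some (q.lower, t.upPart.raise :: N') := by
              simp [unbubble, hup1, hN]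
            by_cases hlt' : t.upPart.pos < q.lower.up
            · rw [unstep_of_lt hN' hup1 hlt', Option.some.injEq] at hr
              subst hr
              simp only; omega
            · rw [unstep_of_not hN' (fun _ => by omega), Option.some.injEq] at hr
              subst hr
              have hql : ¬ q.lower.Prim := hq
              simp only [(dnPart_spec hql).2, hdn2]
              rw [up_lower (by omega)] at hlt'
              rw [dn_lower (by omega)]
              -- The first alternative contradicts `hlt'`; the second is the required inequality.
              rcases h4 q N' hN with h | h <;> omega
        · have := up_lt_dn_add_four ht
          simp only [step]
          rw [if_pos ⟨hup1, by omega⟩, merge_halves ht, h2]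

/-! ### The bijection on sequences and its statistics -/

/-- Strictly increasing sequences of primary parts. -/
def IncPrim (l : List Part) : Prop :=
  (∀ x ∈ l, x.Prim ∧ 1 ≤ x.size) ∧ l.Pairwise (fun x y => x.pos < y.pos)

/-- Read an increasing sequence of primary parts from its largest part on and insert these parts
one after the other. -/
def build (l : List Part) : List Part := l.foldr step []

lemma incPrim_cons {x : Part} {l : List Part} :
    IncPrim (x :: l) ↔ (x.Prim ∧ 1 ≤ x.size) ∧ (∀ y ∈ l, x.pos < y.pos) ∧ IncPrim l := by
  simp only [IncPrim, List.mem_cons, forall_eq_or_imp, List.pairwise_cons]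
  tauto

/-- The second claim carries the induction: the part recovered from the list is the last one
inserted, so `CanAppend` amounts to the sequence being increasing. -/
theorem good_build {l : List Part} (hl : IncPrim l) : Good (build l) ∧
    unstep (build l) = l.head?.map fun x => (x, build l.tail) := by
  induction l with
  | nil => exact ⟨trivial, rfl⟩
  | cons x l ih =>
    obtain ⟨⟨h1, h2⟩, h3, h4⟩ := incPrim_cons.1 hl
    obtain ⟨i1, i2⟩ := ih h4
    refine good_step h1 h2 i1 fun r hr => ?_
    replace hr : unstep (build l) = some r := hr
    rw [i2] at hr
    cases l with
    | nil => simp at hr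
    | cons y l =>
      simp only [List.head?_cons, Option.map_some, Option.some.injEq] at hr
      rw [← hr]
      exact h3 y (by simp)

theorem build_injOn : Set.InjOn build {l | IncPrim l} := by
  intro l hl l' hl' h
  induction l generalizing l' with
  | nil =>
    have h1 := (good_build hl').2
    rw [← h, (good_build hl).2] at h1
    cases l' with
    | nil => rfl
    | cons y l' => simp at h1
  | cons x l ih =>
    have h1 := (good_build hl').2
    rw [← h, (good_build hl).2] at h1
    cases l' with
    | nil => simp at h1
    | cons y l' =>
      simp only [List.head?_cons, Option.map_some, List.tail_cons, Option.some.injEq,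
        Prod.mk.injEq] at h1
      rw [h1.1, ih (incPrim_cons.1 hl).2.2 (incPrim_cons.1 hl').2.2 h1.2]

lemma colorCount_cons (p : Primary) (x : Part) (l : List Part) :
    colorCount p (x :: l) = x.color.factors.count p + colorCount p l := by
  have : x.color.factors.count p = if p ∈ x.color.factors then 1 else 0 := by
    cases x.color <;> cases p <;> rfl
  rw [this, colorCount, List.countP_cons, add_comm]
  simp [colorCount]

lemma weight_cons (x : Part) (l : List Part) : weight (x :: l) = x.size + weight l := by
  simp [weight]

lemma colorCount_bubble (p : Primary) (s : Part) (M : List Part) :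
    colorCount p (bubble s M) = colorCount p (s :: M) := by
  induction M generalizing s with
  | nil => rfl
  | cons q M ih =>
    unfold bubble
    split_ifs
    · simp only [colorCount_cons, ih, raise_color, lower_color]; omega
    · rfl

lemma weight_bubble (s : Part) {M : List Part} (hM : ∀ p ∈ M, 1 ≤ p.size) :
    weight (bubble s M) = weight (s :: M) := by
  induction M generalizing s with
  | nil => rfl
  | cons q M ih =>
    simp only [List.mem_cons, forall_eq_or_imp] at hM
    unfold bubble
    split_ifs
    · simp only [weight_cons, ih _ hM.2, raise, lower]; omega
    · rfl

lemma CanAppend.lt_of_prim {x y : Part} {M : List Part}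
    (h : CanAppend x (y :: M)) (hy : y.Prim) : x.pos < y.pos := by
  cases hb : unbubble (y :: M) with
  | none => exact h _ (unstep_of_none hb)
  | some r =>
    by_cases hc : y.pos < r.1.up
    · exact h _ (unstep_of_lt (t := r.1) (N := r.2) hb hy hc)
    · have := h _ (unstep_of_not (t := r.1) (N := r.2) hb fun _ => by omega)
      have ht := unbubble_not_prim (t := r.1) (N := r.2) hb
      have := dn_lt_up ht
      simp only [(dnPart_spec ht).2] at *
      omega

lemma colorCount_step (p : Primary) {x : Part} {M : List Part} (hx : x.Prim)
    (h : CanAppend x M) : colorCount p (step x M) = colorCount p (x :: M) := by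
  cases M with
  | nil => rfl
  | cons y M =>
    simp only [step]
    split_ifs with hy
    · obtain ⟨-, -, -, hf⟩ := merge_spec hx hy.1 (h.lt_of_prim hy.1) hy.2
      rw [colorCount_bubble, colorCount_cons, hf.count_eq, List.count_append, colorCount_cons,
        colorCount_cons, add_assoc]
    · rfl

lemma weight_step (x : Part) {M : List Part} (hM : Good M) :
    weight (step x M) = weight (x :: M) := by
  cases M with
  | nil => rfl
  | cons y M =>
    simp only [step]
    split_ifs with hy
    · rw [weight_bubble _ hM.tail.one_le_size]
      simp only [weight_cons, merge, add_assoc]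
    · rfl

lemma stat_build {l : List Part} (hl : IncPrim l) :
    (∀ p, colorCount p (build l) = colorCount p l) ∧ weight (build l) = weight l := by
  induction l with
  | nil => exact ⟨fun _ => rfl, rfl⟩
  | cons x l ih =>
    obtain ⟨⟨h1, h2⟩, h3, h4⟩ := incPrim_cons.1 hl
    obtain ⟨i1, i2⟩ := ih h4
    obtain ⟨g1, g2⟩ := good_build h4
    have hc : CanAppend x (build l) := by
      intro r hr
      rw [g2] at hr
      cases l with
      | nil => simp at hr
      | cons y l =>
        simp only [List.head?_cons, Option.map_some, Option.some.injEq] at hr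
        rw [← hr]
        exact h3 y (by simp)
    have hb : build (x :: l) = step x (build l) := rfl
    rw [hb]
    refine ⟨fun p => ?_, ?_⟩
    · rw [colorCount_step p h1 hc, colorCount_cons, colorCount_cons, i1]
    · rw [weight_step x g1, weight_cons, weight_cons, i2]

theorem exists_build {M : List Part} (hM : Good M) : ∃ l, IncPrim l ∧ build l = M := by
  -- Each removal takes away a part of positive size.
  induction hn : weight M using Nat.strong_induction_on generalizing M with
  | _ n ih =>
    cases hu : unstep M with
    | none =>
      cases M with
      | nil => exact ⟨[], by simp [IncPrim], rfl⟩
      | cons p M =>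
        simp only [unstep] at hu
        split at hu
        · simp at hu
        · split_ifs at hu
    | some r =>
      obtain ⟨x, L⟩ := r
      obtain ⟨h1, h2, h3, h4, h5⟩ := good_unstep hM hu
      have hw := weight_step x h3
      rw [h5, weight_cons] at hw
      obtain ⟨l, hl, rfl⟩ := ih (weight L) (by omega) h3 rfl
      refine ⟨x :: l, incPrim_cons.2 ⟨⟨h1, h2⟩, ?_, hl⟩, h5⟩
      cases l with
      | nil => simp
      | cons y l =>
        have hxy : x.pos < y.pos := h4 (y, build l) (good_build hl).2
        obtain ⟨-, h6, -⟩ := incPrim_cons.1 hl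
        simp only [List.mem_cons, forall_eq_or_imp]
        exact ⟨hxy, fun z hz => hxy.trans (h6 z hz)⟩

/-! ### Translation to the table and the forbidden patterns -/

lemma isDistinctPrimary_iff {l : List Part} : IsDistinctPrimary l ↔ IncPrim l.reverse := by
  have key : ∀ x y : Part, x.Prim → y.Prim → (y.Le x ∧ x ≠ y ↔ y.pos < x.pos) := by
    rintro ⟨k, p⟩ ⟨l, q⟩ hx hy
    simp only [Part.Le, pos, ne_eq, Part.mk.injEq]
    rcases Color.eq_of_isPrimary hx with h' | h' | h' | h' <;>
      rcases Color.eq_of_isPrimary hy with h'' | h'' | h'' | h'' <;>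
      simp only at h' h'' <;> subst h' <;> subst h'' <;>
      simp [Color.fst, Color.rank] <;> omega
  simp only [IsDistinctPrimary, IsColoredPartition, IncPrim, List.mem_reverse,
    List.pairwise_reverse, List.Nodup]
  constructor
  · rintro ⟨⟨h1, h2⟩, h3, h4⟩
    refine ⟨fun x hx => ⟨h3 x hx, h1 x hx⟩, ?_⟩
    refine (h2.and h4).imp_of_mem fun {x y} hx hy h => ?_
    exact (key x y (h3 x hx) (h3 y hy)).1 h
  · rintro ⟨h1, h2⟩
    have h3 : l.Pairwise fun x y => y.Le x ∧ x ≠ y :=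
      h2.imp_of_mem fun {x y} hx hy h => (key x y (h1 x hx).1 (h1 y hy).1).2 h
    exact ⟨⟨fun x hx => (h1 x hx).2, h3.imp And.left⟩, fun x hx => (h1 x hx).1, h3.imp And.right⟩

lemma above_iff {P Q : Part} : Above P Q ↔ Q.size + minDiff P.color Q.color ≤ P.size := by
  by_cases hP : P.Prim
  · have : Above P Q ↔ Q.pos + 4 ≤ P.pos := by simp [Above, hP]
    rw [this]
    obtain ⟨k, p⟩ := P
    obtain ⟨l, q⟩ := Q
    simp only [pos, minDiff]
    rcases Color.eq_of_isPrimary hP with h | h | h | h <;> simp only at h <;> subst h <;>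
      cases q <;> simp only [Color.fst, Color.rank, minDiffTable, Matrix.of_apply,
        Matrix.cons_val] <;> omega
  · by_cases hQ : Q.Prim
    · have : Above P Q ↔ Q.pos + 4 < P.pos := by simp [Above, hP, hQ]
      rw [this]
      obtain ⟨k, p⟩ := P
      obtain ⟨l, q⟩ := Q
      simp only [pos, minDiff]
      rcases Color.eq_of_isPrimary hQ with h | h | h | h <;> simp only at h <;> subst h <;>
        rcases Color.eq_of_not_isPrimary hP with h | h | h | h | h | h <;>
        simp only at h <;> subst h <;>
        simp only [Color.fst, Color.rank, minDiffTable, Matrix.of_apply,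
          Matrix.cons_val] <;> omega
    · have : Above P Q ↔ SecAbove P Q := by simp [Above, hP, hQ]
      rw [this, secAbove_iff_minDiff hP hQ]

lemma good_iff {M : List Part} : Good M ↔ (∀ x ∈ M, x.Valid) ∧
    M.IsChain (fun Q P => Above P Q) ∧ ∀ Q P S, [Q, P, S] <:+: M → TripleOK Q P S := by
  induction M with
  | nil => simp [Good]
  | cons Q M ih =>
    cases M with
    | nil => simp [Good, List.infix_cons_iff]
    | cons P M =>
      have h1 : Good (Q :: P :: M) ↔ Q.Valid ∧ Above P Q ∧ HeadOK (Q :: P :: M) ∧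
        Good (P :: M) := Iff.rfl
      have h2 : (∀ Q' P' S, [Q', P', S] <:+: Q :: P :: M → TripleOK Q' P' S) ↔
          HeadOK (Q :: P :: M) ∧ ∀ Q' P' S, [Q', P', S] <:+: P :: M → TripleOK Q' P' S := by
        simp only [List.infix_cons_iff (l₂ := P :: M), or_imp, forall_and]
        refine and_congr_left fun _ => ?_
        cases M with
        | nil => simp [HeadOK]
        | cons S M =>
          simp only [HeadOK, List.cons_prefix_cons, List.nil_prefix, and_true]
          constructor
          · intro h
            exact h Q P S ⟨rfl, rfl, rfl⟩
          · rintro h Q' P' S' ⟨rfl, rfl, rfl⟩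
            exact h
      rw [h1, ih, h2, List.isChain_cons_cons]
      simp only [List.mem_cons, forall_eq_or_imp]
      tauto

/-- The forbidden patterns. -/
def Forbidden (S P Q : Part) : Prop :=
  ∃ k : ℕ, (S = ⟨k + 2, .cd⟩ ∧ P = ⟨k + 2, .ab⟩ ∧ Q = ⟨k, .c⟩) ∨
    (S = ⟨k + 2, .cd⟩ ∧ P = ⟨k + 2, .ab⟩ ∧ Q = ⟨k, .d⟩) ∨
    (k ≠ 1 ∧ S = ⟨k + 2, .ad⟩ ∧ P = ⟨k + 1, .bc⟩ ∧ Q = ⟨k, .a⟩)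

lemma avoidsForbidden_iff {l : List Part} :
    AvoidsForbidden l ↔ ∀ Q P S, [S, P, Q] <:+: l → ¬ Forbidden S P Q := by
  constructor
  · rintro h Q P S hl ⟨k, ⟨rfl, rfl, rfl⟩ | ⟨rfl, rfl, rfl⟩ | ⟨hk, rfl, rfl, rfl⟩⟩
    · exact (h k).1 hl
    · exact (h k).2.1 hl
    · exact (h k).2.2 hk hl
  · intro h k
    refine ⟨fun hl => h _ _ _ hl ⟨k, ?_⟩, fun hl => h _ _ _ hl ⟨k, ?_⟩,
      fun hk hl => h _ _ _ hl ⟨k, ?_⟩⟩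
    · simp
    · simp
    · simp [hk]

lemma tripleOK_iff {Q P S : Part} (hQ : 1 ≤ Q.size) (h1 : Above P Q) (h2 : Above S P) :
    TripleOK Q P S ↔ ¬ Forbidden S P Q := by
  constructor
  · rintro h ⟨k, ⟨rfl, rfl, rfl⟩ | ⟨rfl, rfl, rfl⟩ | ⟨hk, rfl, rfl, rfl⟩⟩
    all_goals
      have h3 := h (by simp only [Part.Prim]; decide) (by simp only [Part.Prim]; decide)
        (by simp only [Part.Prim]; decide)
      simp only [dn, pos, half, Color.fst, Color.snd] at h3
      simp only at hQ
      split_ifs at h3 <;> push_cast at h3 <;> omega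
  · intro h hq hp hs hdn
    by_contra hlt
    apply h
    rw [above_iff] at h1 h2
    obtain ⟨k, q⟩ := Q
    obtain ⟨l, p⟩ := P
    obtain ⟨m, s⟩ := S
    simp only [pos, minDiff] at h1 h2 hlt
    simp only [Forbidden, Part.mk.injEq]
    simp only [dn, pos, half] at hdn
    simp only at hQ
    -- Color triples whose differences contradict `hlt` are discarded. Otherwise the parameter of
    -- the pattern is the size of `Q`; in the third pattern `hdn` excludes `k = 1`, because `2_bc`
    -- has lower half `1_b`, above `1_a`.
    rcases Color.eq_of_isPrimary hq with h | h | h | h <;> simp only at h <;> subst h <;>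
      rcases Color.eq_of_not_isPrimary hp with h | h | h | h | h | h <;>
      simp only at h <;> subst h <;>
      rcases Color.eq_of_not_isPrimary hs with h | h | h | h | h | h <;>
      simp only at h <;> subst h <;>
      simp only [Color.fst, Color.rank, minDiffTable, Matrix.of_apply,
          Matrix.cons_val] at h1 h2 hlt <;>
      first
      | (exfalso; omega)
      | (refine ⟨k, ?_⟩
         simp only [Color.fst, Color.snd] at hdn
         simp only [and_true, and_false, or_false, false_or, reduceCtorEq]
         split_ifs at hdn <;> omega)

lemma isDifferencePartition_iff {l : List Part} :
    IsDifferencePartition l ↔ Good l.reverse := by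
  have hA : (fun x y : Part => y.size + minDiff x.color y.color ≤ x.size) =
      fun x y => Above x y := by
    ext x y
    exact above_iff.symm
  have hV : ∀ x : Part, x.Valid ↔ 0 < x.size ∧ (x.color.IsSecondary → 1 < x.size) := by
    intro x
    rw [Color.isSecondary_iff]
    rfl
  have hT : ∀ Q P S, [S, P, Q] <:+: l → (∀ x ∈ l, 0 < x.size) →
      l.IsChain (fun x y => Above x y) → (TripleOK Q P S ↔ ¬ Forbidden S P Q) := by
    intro Q P S h hp hc
    have hc' := hc.infix h
    simp only [List.isChain_cons_cons] at hc'
    exact tripleOK_iff (hp Q (h.subset (by simp))) hc'.2.1 hc'.1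
  have hR : (∀ Q P S, [Q, P, S] <:+: l.reverse → TripleOK Q P S) ↔
      ∀ Q P S, [S, P, Q] <:+: l → TripleOK Q P S := by
    refine forall_congr' fun Q => forall_congr' fun P => forall_congr' fun S => ?_
    rw [← List.reverse_infix (l₁ := [S, P, Q])]
    rfl
  rw [good_iff, hR, List.isChain_reverse, IsDifferencePartition, IsColoredPartition, hA,
    avoidsForbidden_iff]
  simp only [List.mem_reverse, hV]
  constructor
  · rintro ⟨⟨h1, -⟩, h2, h3, h4⟩
    exact ⟨fun x hx => ⟨h1 x hx, h2 x hx⟩, h3, fun Q P S h => (hT Q P S h h1 h3).2 (h4 Q P S h)⟩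
  · rintro ⟨h1, h3, h4⟩
    refine ⟨⟨fun x hx => (h1 x hx).1, ?_⟩, fun x hx => (h1 x hx).2, h3,
      fun Q P S h => (hT Q P S h (fun x hx => (h1 x hx).1) h3).1 (h4 Q P S h)⟩
    -- The difference conditions alone force the order: the only entry 0 is at `cd, ab`, where the
    -- next color is smaller.
    have htrans : ∀ x y z : Part, y.Le x → z.Le y → z.Le x := by
      intro x y z
      simp only [Part.Le]
      omega
    have hle : ∀ x y : Part, Above x y → y.Le x := by
      rintro ⟨k, p⟩ ⟨l, q⟩ h
      rw [above_iff] at h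
      simp only [minDiff] at h
      simp only [Part.Le]
      revert h
      cases p <;> cases q <;> simp [Color.rank, minDiffTable] <;> omega
    have : Trans (fun x y : Part => y.Le x) (fun x y : Part => y.Le x)
      (fun x y : Part => y.Le x) := ⟨fun {x y z} h h' => htrans x y z h h'⟩
    exact List.isChain_iff_pairwise.1 (h3.imp hle)

lemma hasStatistics_reverse {u v w t n : ℕ} {l : List Part} :
    HasStatistics u v w t n l.reverse ↔ HasStatistics u v w t n l := by
  simp [HasStatistics, colorCount, weight, List.map_reverse, List.sum_reverse]

lemma hasStatistics_build {u v w t n : ℕ} {l : List Part} (hl : IncPrim l) :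
    HasStatistics u v w t n (build l) ↔ HasStatistics u v w t n l := by
  simp only [HasStatistics, (stat_build hl).1, (stat_build hl).2]

/-- The bijection between the partitions counted by `A` and those counted by `B`. -/
theorem bijOn_build (u v w t n : ℕ) :
    Set.BijOn (fun l => (build l.reverse).reverse) (setA u v w t n) (setB u v w t n) := by
  refine ⟨?_, ?_, ?_⟩
  · rintro l ⟨hl, hs⟩
    rw [isDistinctPrimary_iff] at hl
    refine ⟨isDifferencePartition_iff.2 ?_, hasStatistics_reverse.2
      ((hasStatistics_build hl).2 (hasStatistics_reverse.2 hs))⟩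
    rw [List.reverse_reverse]
    exact (good_build hl).1
  · rintro l ⟨hl, -⟩ l' ⟨hl', -⟩ h
    exact List.reverse_injective (build_injOn (isDistinctPrimary_iff.1 hl)
      (isDistinctPrimary_iff.1 hl') (List.reverse_injective h))
  · rintro M ⟨hM, hs⟩
    obtain ⟨l, hl, h⟩ := exists_build (isDifferencePartition_iff.1 hM)
    refine ⟨l.reverse, ⟨isDistinctPrimary_iff.2 ?_, hasStatistics_reverse.2 ?_⟩, ?_⟩
    · rwa [List.reverse_reverse]
    · rw [← hasStatistics_build hl, h, hasStatistics_reverse]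
      exact hs
    · simp only [List.reverse_reverse, h]

/-! ### Finite sets of indices and finiteness -/

/-- The primary color with a given index. -/
def primColor : ℕ → Color
  | 0 => .a
  | 1 => .b
  | 2 => .c
  | _ => .d

/-- The primary part with a given index in the sequence `1_a, 1_b, 1_c, 1_d, 2_a, ⋯`. -/
def primPart (m : ℕ) : Part := ⟨m / 4 + 1, primColor (m % 4)⟩

lemma primPart_spec (m : ℕ) : (primPart m).Prim ∧ (primPart m).pos = m + 4 := by
  have h : m % 4 = 0 ∨ m % 4 = 1 ∨ m % 4 = 2 ∨ m % 4 = 3 := by omega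
  simp only [primPart, pos, Part.Prim]
  rcases h with h | h | h | h <;> rw [h] <;>
    exact ⟨by decide, by simp only [primColor, Color.fst]; omega⟩

/-- The increasing sequence of the primary parts with given indices. -/
def ofFinset (S : Finset ℕ) : List Part := (S.sort (· ≤ ·)).map primPart

lemma incPrim_ofFinset (S : Finset ℕ) : IncPrim (ofFinset S) := by
  refine ⟨fun x hx => ?_, ?_⟩
  · obtain ⟨m, -, rfl⟩ := List.mem_map.1 hx
    exact ⟨(primPart_spec m).1, by simp [primPart]⟩
  · rw [ofFinset, List.pairwise_map]
    refine ((S.pairwise_sort (· ≤ ·)).and (S.sort_nodup (· ≤ ·))).imp ?_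
    rintro i j ⟨h1, h2⟩
    rw [(primPart_spec i).2, (primPart_spec j).2]
    omega

lemma primPart_injective : Function.Injective primPart := by
  intro i j h
  have := congrArg pos h
  rw [(primPart_spec i).2, (primPart_spec j).2] at this
  omega

lemma ofFinset_injective : Function.Injective ofFinset := by
  intro S T h
  have := List.map_injective_iff.2 primPart_injective h
  rw [← S.sort_toFinset (· ≤ ·), this, T.sort_toFinset]

lemma exists_ofFinset {l : List Part} (hl : IncPrim l) : ∃ S, ofFinset S = l := by
  set g : Part → ℕ := fun x => (x.pos - 4).toNat with hg
  have hpos : ∀ x ∈ l, ((g x : ℕ) : ℤ) = x.pos - 4 := by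
    intro x hx
    have := four_le_pos (hl.1 x hx).2
    simp only [hg]; omega
  have hlt : (l.map g).Pairwise (· < ·) := by
    rw [List.pairwise_map]
    refine hl.2.imp_of_mem fun {x y} hx hy h => ?_
    have := hpos x hx
    have := hpos y hy
    omega
  refine ⟨(l.map g).toFinset, ?_⟩
  rw [ofFinset, (List.toFinset_sort (· ≤ ·) (hlt.imp fun h => h.ne)).2 (hlt.imp fun h => h.le),
    List.map_map]
  conv_rhs => rw [← List.map_id l]
  refine List.map_congr_left fun x hx => ?_
  refine eq_of_pos (primPart_spec _).1 (hl.1 x hx).1 ?_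
  rw [Function.comp_apply, (primPart_spec _).2, hpos x hx]
  simp

/-- The statistics of the sequence of primary parts with given indices. -/
def stat (S : Finset ℕ) : ℕ × ℕ × ℕ × ℕ × ℕ :=
  (colorCount .a (ofFinset S), colorCount .b (ofFinset S), colorCount .c (ofFinset S),
    colorCount .d (ofFinset S), weight (ofFinset S))

lemma setA_eq (u v w t n : ℕ) :
    setA u v w t n = (fun S => (ofFinset S).reverse) '' (stat ⁻¹' {(u, v, w, t, n)}) := by
  ext l
  have hs : ∀ S, stat S = (u, v, w, t, n) ↔ HasStatistics u v w t n (ofFinset S) := by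
    intro S
    simp [stat, HasStatistics]
  simp only [setA, Set.mem_ofPred_eq, Set.mem_image, Set.mem_preimage, Set.mem_singleton_iff, hs]
  constructor
  · rintro ⟨h1, h2⟩
    obtain ⟨S, hS⟩ := exists_ofFinset (isDistinctPrimary_iff.1 h1)
    refine ⟨S, ?_, by rw [hS, List.reverse_reverse]⟩
    rw [hS]
    exact hasStatistics_reverse.2 h2
  · rintro ⟨S, h, rfl⟩
    refine ⟨isDistinctPrimary_iff.2 ?_, hasStatistics_reverse.2 h⟩
    rw [List.reverse_reverse]
    exact incPrim_ofFinset S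

lemma finite_stat_fiber (e : ℕ × ℕ × ℕ × ℕ × ℕ) : (stat ⁻¹' {e}).Finite := by
  -- The part with index `m` has size `m / 4 + 1`, at most the weight, so `m` is less than four
  -- times the weight.
  refine (Finset.finite_toSet (Finset.range (4 * e.2.2.2.2)).powerset).subset ?_
  rintro S rfl
  simp only [Finset.coe_powerset, Set.mem_preimage, Set.mem_powerset_iff, Finset.coe_subset]
  intro m hm
  have h : (primPart m).size ≤ weight (ofFinset S) := by
    refine List.single_le_sum (fun _ _ => Nat.zero_le _) _ (List.mem_map_of_mem ?_)
    exact List.mem_map_of_mem ((Finset.mem_sort _).2 hm)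
  simp only [primPart] at h
  simp only [stat, Finset.mem_range]
  omega

lemma finite_setA (u v w t n : ℕ) : (setA u v w t n).Finite := by
  rw [setA_eq]
  exact (finite_stat_fiber _).image _

lemma finite_setB (u v w t n : ℕ) : (setB u v w t n).Finite := by
  rw [← (bijOn_build u v w t n).image_eq]
  exact (finite_setA u v w t n).image _

lemma numA_eq_numB (u v w t n : ℕ) : numA u v w t n = numB u v w t n :=
  (bijOn_build u v w t n).ncard_eq

lemma numB_eq (u v w t n : ℕ) : numB u v w t n = (stat ⁻¹' {(u, v, w, t, n)}).ncard := by
  rw [← numA_eq_numB, numA, setA_eq]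
  exact Set.ncard_image_of_injective _ (List.reverse_injective.comp ofFinset_injective)

/-! ### The generating function -/

section Series

variable {R : Type*} [CommRing R] (a b c d q : R)

/-- The monomial of given exponents. -/
def mon (e : ℕ × ℕ × ℕ × ℕ × ℕ) : R :=
  a ^ e.1 * b ^ e.2.1 * c ^ e.2.2.1 * d ^ e.2.2.2.1 * q ^ e.2.2.2.2

/-- The contribution to the generating function of the primary part with a given index. -/
def partTerm (m : ℕ) : R := ![a, b, c, d] (Fin.ofNat 4 m) * q ^ (m / 4 + 1)

lemma partTerm_add (k : ℕ) (i : Fin 4) :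
    partTerm a b c d q (k * 4 + i) = ![a, b, c, d] i * q ^ (k + 1) := by
  have h1 : Fin.ofNat 4 (k * 4 + i) = i := by
    ext
    simp only [Fin.ofNat]
    omega
  have h2 : (k * 4 + i) / 4 = k := by omega
  rw [partTerm, h1, h2]

lemma prod_partTerm (S : Finset ℕ) : ∏ m ∈ S, partTerm a b c d q m = mon a b c d q (stat S) := by
  have key : ∀ l : List ℕ, (l.map (partTerm a b c d q)).prod =
      mon a b c d q (colorCount .a (l.map primPart), colorCount .b (l.map primPart),
        colorCount .c (l.map primPart), colorCount .d (l.map primPart),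
        weight (l.map primPart)) := by
    intro l
    induction l with
    | nil => simp [mon, colorCount, weight]
    | cons m l ih =>
      rw [List.map_cons, List.prod_cons, ih]
      simp only [List.map_cons, colorCount_cons, weight_cons, mon, partTerm, primPart]
      have h : m % 4 = 0 ∨ m % 4 = 1 ∨ m % 4 = 2 ∨ m % 4 = 3 := by omega
      have h' : ∀ i (hi : i < 4), m % 4 = i → Fin.ofNat 4 m = ⟨i, hi⟩ := by
        intro i hi h
        ext
        exact h
      rcases h with h | h | h | h <;> rw [h, h' _ (by norm_num) h] <;>
        simp [primColor, Color.factors] <;> ring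
  rw [stat, ofFinset, ← key, Finset.prod_eq_multiset_prod, ← S.sort_eq (· ≤ ·), Multiset.map_coe,
    Multiset.prod_coe]

variable [TopologicalSpace R]

lemma hasProd_qPochInf {x : R} (h : Summable fun S : Finset ℕ => ∏ k ∈ S, x * q ^ (k + 1)) :
    HasProd (fun k : ℕ => 1 + x * q ^ (k + 1)) (qPochInf (-x * q) q) ∧
      QPochConverges (-x * q) q := by
  have h1 : (fun k : ℕ => 1 - -x * q * q ^ k) = fun k : ℕ => 1 + x * q ^ (k + 1) := by
    ext k
    ring
  have h2 := multipliable_one_add_of_summable_prod h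
  rw [qPochInf, QPochConverges, h1]
  exact ⟨h2.hasProd, h2⟩

variable [IsTopologicalRing R] [T2Space R]

/-- Both sides equal the sum over finite sets of indices: grouped by statistics, with finite fibers,
it is the series; as an expanded product, split by color, it is the right-hand side. -/
theorem seriesIdentity_of_summable
    (h : ∀ i, Summable fun S : Finset ℕ => ∏ k ∈ S, ![a, b, c, d] i * q ^ (k + 1))
    (h' : Summable fun S : Finset ℕ => ∏ m ∈ S, partTerm a b c d q m) :
    SeriesIdentity a b c d q := by
  obtain ⟨ha, ha'⟩ := hasProd_qPochInf q (h 0)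
  obtain ⟨hb, hb'⟩ := hasProd_qPochInf q (h 1)
  obtain ⟨hc, hc'⟩ := hasProd_qPochInf q (h 2)
  obtain ⟨hd, hd'⟩ := hasProd_qPochInf q (h 3)
  refine ⟨⟨ha', hb', hc', hd'⟩, ?_⟩
  obtain ⟨P, hP⟩ := h'
  have hsum : HasSum (fun e : ℕ × ℕ × ℕ × ℕ × ℕ =>
      (numB e.1 e.2.1 e.2.2.1 e.2.2.2.1 e.2.2.2.2 : R) * mon a b c d q e) P := by
    rw [← (Equiv.sigmaFiberEquiv stat).hasSum_iff] at hP
    refine hP.sigma fun e => ?_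
    have hfin : Finite {S // stat S = e} := (finite_stat_fiber e).to_subtype
    have := Fintype.ofFinite {S // stat S = e}
    convert hasSum_fintype _ using 1
    have hterm : ∀ S : {S // stat S = e}, ∏ m ∈ (S : Finset ℕ), partTerm a b c d q m =
        mon a b c d q e := by
      rintro ⟨S, rfl⟩
      exact prod_partTerm a b c d q S
    simp only [Function.comp_apply, Equiv.sigmaFiberEquiv_apply, hterm, Finset.sum_const,
      nsmul_eq_mul, Finset.card_univ]
    rw [numB_eq, ← Nat.card_eq_fintype_card]
    rfl
  have hprod : P = qPochInf (-a * q) q * qPochInf (-b * q) q * qPochInf (-c * q) q *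
      qPochInf (-d * q) q := by
    have h1 := hasProd_one_add_of_hasSum_prod hP
    -- Writing the index as `4k + i` collects the factors of each color `i`.
    rw [← ((Equiv.prodComm (Fin 4) ℕ).trans (Nat.divModEquiv 4).symm).hasProd_iff] at h1
    have h2 := h1.prod_fiberwise (g := ![qPochInf (-a * q) q, qPochInf (-b * q) q,
      qPochInf (-c * q) q, qPochInf (-d * q) q]) ?_
    · rw [h2.unique (hasProd_fintype _), Fin.prod_univ_four]
      rfl
    · intro i
      simp only [Function.comp_def, Equiv.trans_apply, Equiv.prodComm_apply, Prod.swap_prod_mk,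
        Nat.divModEquiv_symm_apply, partTerm_add]
      fin_cases i
      · exact ha
      · exact hb
      · exact hc
      · exact hd
  rw [← hprod]
  exact hsum

end Series

/-! ### Convergence over the complex numbers and for formal power series -/

theorem seriesIdentity_complex (a b c d : ℂ) {q : ℂ} (hq : ‖q‖ < 1) :
    SeriesIdentity a b c d q := by
  have hgeo : ∀ x : ℂ, Summable fun k : ℕ => ‖x * q ^ (k + 1)‖ := by
    intro x
    have h := (summable_geometric_of_lt_one (norm_nonneg q) hq).mul_left (‖x‖ * ‖q‖)
    refine h.congr fun k => ?_
    rw [norm_mul, norm_pow, pow_succ]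
    ring
  refine seriesIdentity_of_summable a b c d q
    (fun i => summable_finsetProd_of_summable_norm (hgeo _))
    (summable_finsetProd_of_summable_norm ?_)
  rw [← (Nat.divModEquiv 4).symm.summable_iff, ← (Equiv.prodComm (Fin 4) ℕ).summable_iff]
  refine (summable_prod_of_nonneg fun _ => norm_nonneg _).2
    ⟨fun i => ?_, (hasSum_fintype _).summable⟩
  refine (hgeo (![a, b, c, d] i)).congr fun k => ?_
  simp only [Equiv.prodComm_apply, Prod.swap_prod_mk,
    Nat.divModEquiv_symm_apply, partTerm_add]

theorem seriesIdentity_mvPowerSeries : SeriesIdentity (R := MvPowerSeries Var ℤ)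
    (MvPowerSeries.X .a) (MvPowerSeries.X .b) (MvPowerSeries.X .c) (MvPowerSeries.X .d)
    (MvPowerSeries.X .q) := by
  have hord : ∀ (x : MvPowerSeries Var ℤ) (k : ℕ),
      (k : ℕ∞) ≤ (x * MvPowerSeries.X Var.q ^ (k + 1)).order := by
    intro x k
    have h1 := MvPowerSeries.le_order_pow_of_constantCoeff_eq_zero (k + 1)
      (MvPowerSeries.constantCoeff_X (R := ℤ) Var.q)
    refine le_trans ?_ (MvPowerSeries.le_order_mul)
    refine le_trans (le_trans ?_ h1) le_add_self
    exact_mod_cast Nat.le_succ k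
  have htop : ∀ {f : ℕ → MvPowerSeries Var ℤ} {g : ℕ → ℕ},
      Filter.Tendsto g Filter.atTop Filter.atTop → (∀ k, (g k : ℕ∞) ≤ (f k).order) →
      Summable fun S : Finset ℕ => ∏ k ∈ S, f k := by
    intro f g hg hf
    apply MvPowerSeries.WithPiTopology.summable_prod_of_tendsto_order_atTop_nhds_top
    rw [ENat.tendsto_nhds_top_iff_natCast_lt]
    intro n
    filter_upwards [hg.eventually_gt_atTop n] with k hk
    exact lt_of_lt_of_le (by exact_mod_cast hk) (hf k)
  refine seriesIdentity_of_summable _ _ _ _ _ (fun i => htop Filter.tendsto_id (hord _)) ?_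
  exact htop (Nat.tendsto_div_const_atTop (by norm_num)) fun m => hord _ (m / 4)

end TenColors

theorem theorem1p5 :
    (∀ u v w t n : ℕ,
      (TenColors.setA u v w t n).Finite ∧ (TenColors.setB u v w t n).Finite ∧
        TenColors.numA u v w t n = TenColors.numB u v w t n) ∧
    -- the identity of formal power series in `a, b, c, d, q` (coefficientwise convergence)
    TenColors.SeriesIdentity (R := MvPowerSeries TenColors.Var ℤ)
      (MvPowerSeries.X .a) (MvPowerSeries.X .b) (MvPowerSeries.X .c) (MvPowerSeries.X .d)
      (MvPowerSeries.X .q) ∧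
    -- the identity of complex numbers
    (∀ a b c d q : ℂ, ‖q‖ < 1 → TenColors.SeriesIdentity a b c d q) :=
  ⟨fun u v w t n => ⟨TenColors.finite_setA u v w t n, TenColors.finite_setB u v w t n,
      TenColors.numA_eq_numB u v w t n⟩,
    TenColors.seriesIdentity_mvPowerSeries,
    fun a b c d _ hq => TenColors.seriesIdentity_complex a b c d hq⟩
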